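/- Let $R=[r^1,\dots,r^k]\in\mathbb{Q}^{2\times k}$ have nonzero columns, let $f\in\mathbb{Q}^2\setminus\mathbb{Z}^2$, and put $$P(R,f)=\{(x,s)\in\mathbb{Z}^2\times\mathbb{R}^k_+ \mid x=f+Rs\},\qquad P(R,f)^0=\{(x,s)\in\mathbb{R}^2\times\mathbb{R}^k_+ \mid x=f+Rs\}.$$ For $n\ge 0$ let $$P(R,f)^{n+1}=\bigcap_{\pi\in\mathbb{Z}^2,\ \pi_0\in\mathbb{Z}}\operatorname{conv}\Big(\{(x,s)\in P(R,f)^n\mid \pi^Tx\le\pi_0\}\cup\{(x,s)\in P(R,f)^n\mid \pi^Tx\ge\pi_0+1\}\Big)$$ be the $(n+1)$-st split closure. The split rank of an inequality is the least $n$ for which it is valid for $P(R,f)^n$, and $+\infty$ if there is no such $n$. Let $\alpha\in\mathbb{R}^k_+$ be such that $\sum_{i=1}^k\alpha_is_i\ge 1$ is valid for $\operatorname{conv}(P(R,f))$. Its induced lattice-free set is $$L_\alpha=\operatorname{conv}\Big(\{f\}\cup\Big\{f+\frac{r^i}{\alpha_i}\;\Big|\;\alpha_i>0\Big\}\Big)+\operatorname{cone}\{r^i\mid\alpha_i=0\}.$$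 A quadrilateral of type $Q^2$ is a convex quadrilateral in $\mathbb{R}^2$ that has no integer point in its interior, has four non-integral vertices, and contains exactly one integer point in the relative interior of each of its four sides. **Proposition.** If $L_\alpha$ is a quadrilateral of type $Q^2$, then the split rank of $\sum_{i=1}^k\alpha_is_i\ge 1$ is finite. -/

import Mathlib

open scoped Pointwise

noncomputable section

/-- The integer lattice `ℤ²` inside the plane `ℝ²`. -/
def integerPoints : Set (Fin 2 → ℝ) :=
  {x | ∀ i, ∃ n : ℤ, x i = n}

/-- A set in the plane is lattice-free if its interior contains no integer point. -/
def LatticeFree (S : Set (Fin 2 → ℝ)) : Prop :=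
  Disjoint (interior S) integerPoints

/-- The rational vector `f`, as a point of `ℝ²`. -/
def realPoint (f : Fin 2 → ℚ) : Fin 2 → ℝ := fun i => (f i : ℝ)

/-- The `j`-th column `r^j` of the rational matrix `R`, as a vector of `ℝ²`. -/
def column {k : ℕ} (R : Matrix (Fin 2) (Fin k) ℚ) (j : Fin k) : Fin 2 → ℝ :=
  fun i => (R i j : ℝ)

/-- The linear relaxation `P(R,f)^0 = {(x,s) ∈ ℝ² × ℝ₊^k | x = f + R s}`. -/
def relaxation {k : ℕ} (R : Matrix (Fin 2) (Fin k) ℚ) (f : Fin 2 → ℚ) :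
    Set ((Fin 2 → ℝ) × (Fin k → ℝ)) :=
  {z | (∀ j, 0 ≤ z.2 j) ∧ z.1 = realPoint f + ∑ j, z.2 j • column R j}

/-- The mixed integer set `P(R,f) = {(x,s) ∈ ℤ² × ℝ₊^k | x = f + R s}`. -/
def mixedIntegerSet {k : ℕ} (R : Matrix (Fin 2) (Fin k) ℚ) (f : Fin 2 → ℚ) :
    Set ((Fin 2 → ℝ) × (Fin k → ℝ)) :=
  {z ∈ relaxation R f | z.1 ∈ integerPoints}

/-- The inequality `∑ α_j s_j ≥ γ` is valid for the set `K` of points `(x,s)`. -/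
def IsValidInequality {k : ℕ} (K : Set ((Fin 2 → ℝ) × (Fin k → ℝ)))
    (α : Fin k → ℝ) (γ : ℝ) : Prop :=
  ∀ z ∈ K, γ ≤ ∑ j, α j * z.2 j

/-- The convex hull `K_{π,π₀}` of the two parts of `K` that satisfy the split disjunction
`π·x ≤ π₀` or `π·x ≥ π₀ + 1`. -/
def splitHull {k : ℕ} (K : Set ((Fin 2 → ℝ) × (Fin k → ℝ))) (π : Fin 2 → ℤ) (π₀ : ℤ) :
    Set ((Fin 2 → ℝ) × (Fin k → ℝ)) :=
  convexHull ℝ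
    ({z ∈ K | ∑ i, (π i : ℝ) * z.1 i ≤ (π₀ : ℝ)} ∪
      {z ∈ K | (π₀ : ℝ) + 1 ≤ ∑ i, (π i : ℝ) * z.1 i})

/-- The split closure: the intersection of `K_{π,π₀}` over all split disjunctions. -/
def splitClosure {k : ℕ} (K : Set ((Fin 2 → ℝ) × (Fin k → ℝ))) :
    Set ((Fin 2 → ℝ) × (Fin k → ℝ)) :=
  ⋂ (π : Fin 2 → ℤ) (π₀ : ℤ), splitHull K π π₀

/-- The split rank of `∑ α_j s_j ≥ γ` with respect to `K`: the least `n` such that the inequality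
is valid for the `n`-th split closure of `K`, and `⊤` if there is no such `n`. -/
def splitRank {k : ℕ} (K : Set ((Fin 2 → ℝ) × (Fin k → ℝ))) (α : Fin k → ℝ) (γ : ℝ) : ℕ∞ :=
  sInf {m : ℕ∞ | ∃ n : ℕ, m = n ∧ IsValidInequality (splitClosure^[n] K) α γ}

/-- The induced lattice-free set
`L_α = conv ({f} ∪ {f + r^j / α_j | α_j > 0}) + cone {r^j | α_j = 0}`. -/
def inducedSet {k : ℕ} (R : Matrix (Fin 2) (Fin k) ℚ) (f : Fin 2 → ℚ) (α : Fin k → ℝ) :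
    Set (Fin 2 → ℝ) :=
  convexHull ℝ
      ({p | ∃ j, 0 < α j ∧ p = realPoint f + (1 / α j) • column R j} ∪ {realPoint f}) +
    {d | ∃ t : Fin k → ℝ, (∀ j, 0 ≤ t j) ∧ (∀ j, α j ≠ 0 → t j = 0) ∧
      d = ∑ j, t j • column R j}

/-- Twice the signed area of the triangle `a b c`; it is positive exactly when the path
`a, b, c` makes a strict left turn. -/
def leftTurn (a b c : Fin 2 → ℝ) : ℝ :=
  (b 0 - a 0) * (c 1 - a 1) - (b 1 - a 1) * (c 0 - a 0)

/-- `Q` is a lattice-free quadrilateral of type `Q²`. The vertices `v 0, v 1, v 2, v 3` are listed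
counterclockwise (four strict left turns), so the sides are the segments from `v i` to `v (i + 1)`,
with indices modulo `4`. No vertex is integral, and the relative interior of each side contains
exactly one integer point. -/
def IsType2Quadrilateral (Q : Set (Fin 2 → ℝ)) : Prop :=
  LatticeFree Q ∧
  ∃ v : Fin 4 → Fin 2 → ℝ,
    Q = convexHull ℝ (Set.range v) ∧
    (∀ i, 0 < leftTurn (v i) (v (i + 1)) (v (i + 2))) ∧
    (∀ i, v i ∉ integerPoints) ∧
    (∀ i, ∃! y, y ∈ integerPoints ∧ y ∈ openSegment ℝ (v i) (v (i + 1)))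

end

/-! ### Iterated split closures and integer affine forms -/

section SplitClosure

variable {k : ℕ}

/-! The integer points on the four sides of `L_α` form a fundamental parallelogram of the lattice
(`exists_int_coordinates`, `side_points_parallelogram`). In suitable integer affine coordinates `X`,
`Y` they are the corners of the unit square. Since `f` lies strictly inside every side, each side
gives an inequality valid for the relaxation: the height `∑ α_j s_j` plus an affine form is at least
1, where the form vanishes at that side's corner and is positive at the two adjacent ones.

Splitting on `X` and then on `Y` shrinks any uniform deficit `ε` in `height ≥ 1 - ε` by a fixed
factor (`exists_edge_contraction`). Every `ε > 0` is thus reached, but this alone need not reach 0.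
To close the gap, `exists_flat_corner` rotates a corner inequality about its corner by a split `P X
+ Q Y` nearly parallel to its side. On the far side of that split, a small deficit suffices near the
corner, and linear growth of the height in `|X|` suffices far away. The original and the rotated
inequalities together give height at least 1 along two opposite edges of the square
(`exists_edge_inequality`), and one last split on `Y` joins them. -/

theorem splitClosure_subset {K : Set ((Fin 2 → ℝ) × (Fin k → ℝ))} (hK : Convex ℝ K) :
    splitClosure K ⊆ K := fun _ hz =>
  convexHull_min (Set.union_subset (Set.sep_subset _ _) (Set.sep_subset _ _)) hK
    (Set.mem_iInter₂.1 hz 0 0)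

theorem convex_splitClosure (K : Set ((Fin 2 → ℝ) × (Fin k → ℝ))) :
    Convex ℝ (splitClosure K) :=
  convex_iInter₂ fun _ _ => convex_convexHull ℝ _

theorem convex_iterate_splitClosure {K : Set ((Fin 2 → ℝ) × (Fin k → ℝ))} (hK : Convex ℝ K)
    (n : ℕ) : Convex ℝ (splitClosure^[n] K) := by
  cases n with
  | zero => exact hK
  | succ n => rw [Function.iterate_succ_apply']; exact convex_splitClosure _

theorem antitone_iterate_splitClosure {K : Set ((Fin 2 → ℝ) × (Fin k → ℝ))} (hK : Convex ℝ K) :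
    Antitone fun n => splitClosure^[n] K := by
  refine antitone_nat_of_succ_le fun n => ?_
  rw [Function.iterate_succ_apply']
  exact splitClosure_subset (convex_iterate_splitClosure hK n)

/-- The property `p` holds on some iterated split closure of `K`. -/
def EventuallyOnClosures (K : Set ((Fin 2 → ℝ) × (Fin k → ℝ)))
    (p : (Fin 2 → ℝ) × (Fin k → ℝ) → Prop) : Prop :=
  ∃ n : ℕ, ∀ z ∈ splitClosure^[n] K, p z

namespace EventuallyOnClosures

variable {K : Set ((Fin 2 → ℝ) × (Fin k → ℝ))} {p q : (Fin 2 → ℝ) × (Fin k → ℝ) → Prop}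

theorem of_forall_mem (h : ∀ z ∈ K, p z) : EventuallyOnClosures K p := ⟨0, h⟩

theorem mono (hp : EventuallyOnClosures K p) (h : ∀ z, p z → q z) :
    EventuallyOnClosures K q :=
  hp.imp fun _ hn z hz => h z (hn z hz)

theorem and (hK : Convex ℝ K) (hp : EventuallyOnClosures K p) (hq : EventuallyOnClosures K q) :
    EventuallyOnClosures K fun z => p z ∧ q z := by
  obtain ⟨m, hm⟩ := hp
  obtain ⟨n, hn⟩ := hq
  exact ⟨max m n, fun z hz =>
    ⟨hm z (antitone_iterate_splitClosure hK (le_max_left m n) hz),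
      hn z (antitone_iterate_splitClosure hK (le_max_right m n) hz)⟩⟩

end EventuallyOnClosures

/-- An affine form in `x` with integer coefficients, viewed as a function of `(x, s)`. -/
def IsIntegerForm (W : (Fin 2 → ℝ) × (Fin k → ℝ) → ℝ) : Prop :=
  ∃ (π : Fin 2 → ℤ) (c : ℤ), ∀ z, W z = ∑ i, (π i : ℝ) * z.1 i + c

namespace IsIntegerForm

variable {W V : (Fin 2 → ℝ) × (Fin k → ℝ) → ℝ}

theorem add (hW : IsIntegerForm W) (hV : IsIntegerForm V) :
    IsIntegerForm fun z => W z + V z := by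
  obtain ⟨π, c, h⟩ := hW
  obtain ⟨ρ, d, h'⟩ := hV
  refine ⟨π + ρ, c + d, fun z => ?_⟩
  simp only [h, h', Fin.sum_univ_two, Pi.add_apply, Int.cast_add]
  ring

theorem intCast_mul (hW : IsIntegerForm W) (m : ℤ) : IsIntegerForm fun z => m * W z := by
  obtain ⟨π, c, h⟩ := hW
  refine ⟨fun i => m * π i, m * c, fun z => ?_⟩
  simp only [h, Fin.sum_univ_two, Int.cast_mul]
  ring

theorem one_sub (hW : IsIntegerForm W) : IsIntegerForm fun z => 1 - W z := by
  obtain ⟨π, c, h⟩ := hW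
  refine ⟨-π, 1 - c, fun z => ?_⟩
  simp only [h, Fin.sum_univ_two, Pi.neg_apply, Int.cast_neg, Int.cast_sub, Int.cast_one]
  ring

theorem map_combo (hW : IsIntegerForm W) {a b : ℝ} (hab : a + b = 1)
    (y z : (Fin 2 → ℝ) × (Fin k → ℝ)) : W (a • y + b • z) = a * W y + b * W z := by
  obtain ⟨π, c, h⟩ := hW
  simp only [h, Fin.sum_univ_two, Prod.fst_add, Prod.smul_fst, Pi.add_apply, Pi.smul_apply,
    smul_eq_mul]
  linear_combination (-c : ℝ) * hab

end IsIntegerForm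

/-- The height `∑ α_j s_j` of the point `(x, s)`. -/
def height (α : Fin k → ℝ) (z : (Fin 2 → ℝ) × (Fin k → ℝ)) : ℝ := ∑ j, α j * z.2 j

theorem height_combo (α : Fin k → ℝ) (a b : ℝ) (y z : (Fin 2 → ℝ) × (Fin k → ℝ)) :
    height α (a • y + b • z) = a * height α y + b * height α z := by
  simp only [height, Prod.snd_add, Prod.smul_snd, Pi.add_apply, Pi.smul_apply, smul_eq_mul,
    Finset.mul_sum, ← Finset.sum_add_distrib]
  exact Finset.sum_congr rfl fun _ _ => by ring

variable {K : Set ((Fin 2 → ℝ) × (Fin k → ℝ))} {α : Fin k → ℝ}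
  {X Y W : (Fin 2 → ℝ) × (Fin k → ℝ) → ℝ}

theorem convex_le_height_add (hX : IsIntegerForm X) (hY : IsIntegerForm Y) (c u v : ℝ) :
    Convex ℝ {z | c ≤ height α z + u * X z + v * Y z} := by
  intro y hy z hz a b ha hb hab
  simp only [Set.mem_ofPred_eq] at hy hz ⊢
  rw [height_combo, hX.map_combo hab, hY.map_combo hab]
  calc c = a * c + b * c := by rw [← add_mul, hab, one_mul]
    _ ≤ a * (height α y + u * X y + v * Y y) + b * (height α z + u * X z + v * Y z) := by gcongr
    _ = _ := by ring

/-- An inequality that holds on both sides of a split disjunction holds one closure later. -/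
theorem EventuallyOnClosures.of_split (hX : IsIntegerForm X) (hY : IsIntegerForm Y)
    (hW : IsIntegerForm W) {c u v : ℝ}
    (h : EventuallyOnClosures K fun z =>
      (W z ≤ 0 ∨ 1 ≤ W z) → c ≤ height α z + u * X z + v * Y z) :
    EventuallyOnClosures K fun z => c ≤ height α z + u * X z + v * Y z := by
  obtain ⟨n, hn⟩ := h
  obtain ⟨π, d, hπ⟩ := hW
  refine ⟨n + 1, fun z hz => ?_⟩
  rw [Function.iterate_succ_apply'] at hz
  -- Taking `π₀ = -d` absorbs the constant of `W`, so the two sides of the split are `W ≤ 0` and `1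
  -- ≤ W`.
  refine convexHull_min ?_ (convex_le_height_add hX hY c u v) (Set.mem_iInter₂.1 hz π (-d))
  rintro y (⟨hy, hy'⟩ | ⟨hy, hy'⟩) <;> refine hn y hy ?_ <;> rw [hπ] <;> push_cast at hy'
  · left; linarith
  · right; linarith

end SplitClosure

/-! ### Deriving height at least 1 from the four corner inequalities -/

section Derivation

variable {k : ℕ} {K : Set ((Fin 2 → ℝ) × (Fin k → ℝ))} {α : Fin k → ℝ}
  {X Y : (Fin 2 → ℝ) × (Fin k → ℝ) → ℝ}

/-- A valid inequality that is tight at height one over the lattice point `X = Y = 0` can be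
rotated around that point, by a split almost parallel to its side, until it is almost flat. -/
theorem exists_flat_corner (hK : Convex ℝ K) (hX : IsIntegerForm X) (hY : IsIntegerForm Y)
    {a₁ a₂ : ℝ} (ha₁ : 0 < a₁) (ha₂ : 0 < a₂)
    (hA : EventuallyOnClosures K fun z => 1 ≤ height α z + a₁ * X z + a₂ * Y z)
    {κ C : ℝ} (hκ : 0 < κ) (hgrow : EventuallyOnClosures K fun z => κ * |X z| - C ≤ height α z)
    (hdef : ∀ ε > 0, EventuallyOnClosures K fun z => 1 - ε ≤ height α z)
    {ρ : ℝ} (hρ : 0 < ρ) (hρ1 : ρ < 1) :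
    ∃ τ ≥ 0, EventuallyOnClosures K fun z => 1 ≤ height α z + τ * X z + (ρ * a₂) * Y z := by
  -- With `|e| ≤ 1 / (n + 1)` below, these bounds give, in order: `τ ≥ 0`; an error term at most
  -- half the growth rate `κ`; `n ≥ 1` for Dirichlet; and growth that beats `C` once `|e * x| > ρ /
  -- 2`.
  obtain ⟨n, hn⟩ := exists_nat_ge (max (max (a₂ / (ρ * a₁)) (2 * a₂ / κ))
    (max 1 (4 * (C + 1) / (κ * ρ))))
  have hn1 : (1 : ℝ) ≤ n := ((le_max_left _ _).trans (le_max_right _ _)).trans hn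
  have h1 : a₂ ≤ ρ * a₁ * (n + 1) := by
    have := ((le_max_left _ _).trans (le_max_left _ _)).trans hn
    rw [div_le_iff₀ (by positivity)] at this
    nlinarith [mul_pos hρ ha₁]
  have h2 : 2 * a₂ ≤ κ * (n + 1) := by
    have := ((le_max_right _ _).trans (le_max_left _ _)).trans hn
    rw [div_le_iff₀ (by positivity)] at this
    nlinarith
  have h3 : 4 * (C + 1) ≤ κ * ρ * (n + 1) := by
    have := ((le_max_right _ _).trans (le_max_right _ _)).trans hn
    rw [div_le_iff₀ (by positivity)] at this
    nlinarith [mul_pos hκ hρ]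
  obtain ⟨P, Q, hQ, -, hPQ⟩ := Real.exists_int_int_abs_mul_sub_le (a₁ / a₂)
    (n := n) (by exact_mod_cast hn1)
  have hQ1 : (1 : ℝ) ≤ Q := by exact_mod_cast hQ
  have hQ0 : (0 : ℝ) < Q := by linarith
  obtain ⟨e, he⟩ : ∃ e : ℝ, e = P - Q * (a₁ / a₂) := ⟨_, rfl⟩
  have hP : (P : ℝ) = e + Q * (a₁ / a₂) := by linarith
  have hen : |e| * (n + 1) ≤ 1 := by
    rw [abs_sub_comm, ← he, le_div_iff₀ (by positivity)] at hPQ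
    exact hPQ
  have hsQ : a₂ / Q ≤ a₂ := div_le_self ha₂.le hQ1
  have hsQ0 : 0 < a₂ / Q := by positivity
  have heN : a₂ * |e| ≤ ρ * a₁ ∧ 2 * (a₂ * |e|) ≤ κ := by
    constructor
    · calc a₂ * |e| ≤ ρ * a₁ * (n + 1) * |e| := by gcongr
        _ = ρ * a₁ * (|e| * (n + 1)) := by ring
        _ ≤ ρ * a₁ * 1 := by gcongr
        _ = ρ * a₁ := mul_one _
    · calc 2 * (a₂ * |e|) = 2 * a₂ * |e| := by ring
        _ ≤ κ * (n + 1) * |e| := by gcongr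
        _ = κ * (|e| * (n + 1)) := by ring
        _ ≤ κ * 1 := by gcongr
        _ = κ := mul_one _
  -- The new form is `a₁ X + a₂ Y` minus `(1 - ρ) (a₂ / Q) (P X + Q Y)`, so it only improves on `hA`
  -- where `P X + Q Y ≤ 0`.
  refine ⟨ρ * a₁ - (1 - ρ) * (a₂ / Q) * e, ?_, ?_⟩
  · have h4 : (1 - ρ) * (a₂ / Q) * e ≤ (1 - ρ) * (a₂ / Q) * |e| := by
      have : 0 ≤ 1 - ρ := by linarith
      gcongr
      exact le_abs_self e
    have h5 : (1 - ρ) * (a₂ / Q) * |e| ≤ 1 * a₂ * |e| := by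
      gcongr
      linarith
    linarith [heN.1]
  · refine EventuallyOnClosures.of_split hX hY
      ((hX.intCast_mul P).add (hY.intCast_mul Q)) ?_
    refine ((hA.and hK hgrow).and hK (hdef (a₂ / Q * (ρ / 2)) (by positivity))).mono ?_
    rintro z ⟨⟨hz1, hz2⟩, hz3⟩ hW
    set x := X z
    set y := Y z
    set H := height α z
    have hT1 : (ρ * a₁ - (1 - ρ) * (a₂ / Q) * e) * x + ρ * a₂ * y =
        a₁ * x + a₂ * y - (1 - ρ) * (a₂ / Q) * (P * x + Q * y) := by
      rw [hP]; field_simp; ring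
    have hT2 : (ρ * a₁ - (1 - ρ) * (a₂ / Q) * e) * x + ρ * a₂ * y =
        a₂ / Q * (ρ * (P * x + Q * y) - e * x) := by
      rw [hP]; field_simp; ring
    rcases hW with hW | hW
    · have : (1 - ρ) * (a₂ / Q) * (P * x + Q * y) ≤ 0 :=
        mul_nonpos_of_nonneg_of_nonpos (by nlinarith) hW
      linarith
    · have hρW : ρ ≤ ρ * (P * x + Q * y) := le_mul_of_one_le_right hρ.le hW
      -- If the approximation error is small, the new form is at least `a₂ / Q * (ρ / 2)`, which
      -- pays for the deficit. Otherwise `|x|` is large and `hgrow` takes over.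
      by_cases hx : |e * x| ≤ ρ / 2
      · have : a₂ / Q * (ρ / 2) ≤ a₂ / Q * (ρ * (P * x + Q * y) - e * x) := by
          gcongr
          linarith [le_abs_self (e * x)]
        linarith
      · push Not at hx
        rw [abs_mul] at hx
        have hx' : ρ / 2 * (n + 1) ≤ |x| := by
          calc ρ / 2 * (n + 1) ≤ |e| * |x| * (n + 1) := by gcongr
            _ = (|e| * (n + 1)) * |x| := by ring
            _ ≤ 1 * |x| := by gcongr
            _ = |x| := one_mul _
        have h5 : a₂ / Q * (-(|e| * |x|)) ≤ a₂ / Q * (ρ * (P * x + Q * y) - e * x) := by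
          gcongr
          rw [← abs_mul]
          linarith [le_abs_self (e * x)]
        have h6 : a₂ / Q * (|e| * |x|) ≤ a₂ * (|e| * |x|) := by gcongr
        have h7 : 2 * (a₂ * |e|) * |x| ≤ κ * |x| := by gcongr; exact heN.2
        have h8 : κ * (ρ / 2 * (n + 1)) ≤ κ * |x| := by gcongr
        linarith

/-- If two corners of the unit square carry tight valid inequalities, then all deficits on the
edge between them and beyond it shrink by a constant factor. -/
theorem exists_edge_contraction (hK : Convex ℝ K) (hX : IsIntegerForm X) (hY : IsIntegerForm Y)
    {a₁ a₂ b₁ b₂ : ℝ} (ha₁ : 0 < a₁) (ha₂ : 0 < a₂) (hb₁ : 0 < b₁) (hb₂ : 0 < b₂)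
    (hA : EventuallyOnClosures K fun z => 1 ≤ height α z + a₁ * X z + a₂ * Y z)
    (hB : EventuallyOnClosures K fun z => 1 ≤ height α z + b₁ * (1 - X z) + b₂ * Y z) :
    ∃ θ : ℝ, 0 ≤ θ ∧ θ < 1 ∧ ∃ M > 0, ∀ ε ≥ 0,
      (EventuallyOnClosures K fun z => 1 - ε ≤ height α z) →
      EventuallyOnClosures K fun z => 1 - θ * ε ≤ height α z + M * Y z := by
  obtain ⟨M, hM⟩ : ∃ M, M = min a₂ b₂ := ⟨_, rfl⟩
  obtain ⟨N, hN⟩ : ∃ N, N = max a₂ b₂ := ⟨_, rfl⟩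
  have hM0 : 0 < M := hM ▸ lt_min ha₂ hb₂
  have haN : a₂ ≤ N := hN ▸ le_max_left _ _
  have hbN : b₂ ≤ N := hN ▸ le_max_right _ _
  have hMa : M ≤ a₂ := hM ▸ min_le_left _ _
  have hMb : M ≤ b₂ := hM ▸ min_le_right _ _
  have hN0 : 0 < N := by linarith
  -- Average `1 - ε ≤ H` and `1 ≤ H + s * y` with weight `M / s` on the latter. Both sides of the
  -- split must reach the same slope `M`, hence the minimum; `N` bounds the leftover deficit
  -- uniformly.
  have key : ∀ {s ε H y : ℝ}, M ≤ s → s ≤ N → 0 ≤ ε → 1 - ε ≤ H → 1 ≤ H + s * y →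
      1 - (1 - M / N) * ε ≤ H + M * y := by
    intro s ε H y hMs hsN hε h1 h2
    have hs : 0 < s := by linarith
    have hl1 : M / s ≤ 1 := (div_le_one hs).2 hMs
    have hl2 : M / N ≤ M / s := by gcongr
    have h3 : (1 - M / s) * (1 - ε) + M / s * 1 ≤ (1 - M / s) * H + M / s * (H + s * y) := by
      gcongr
    have h4 : M / s * (s * y) = M * y := by field_simp
    have h5 : M / N * ε ≤ M / s * ε := by gcongr
    linarith
  refine ⟨1 - M / N, ?_, ?_, M, hM0, fun ε hε h => ?_⟩
  · linarith [(div_le_one hN0).2 (hMa.trans haN)]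
  · linarith [div_pos hM0 hN0]
  · have := EventuallyOnClosures.of_split (α := α) (c := 1 - (1 - M / N) * ε) (u := 0) (v := M)
      hX hY hX (((hA.and hK hB).and hK h).mono ?_)
    · exact this.mono fun z hz => by linarith
    · rintro z ⟨⟨h1, h2⟩, h3⟩ hW
      rcases hW with hW | hW
      · have := key hMa haN hε h3 (y := Y z) (by nlinarith)
        linarith
      · have := key hMb hbN hε h3 (y := Y z) (by nlinarith)
        linarith

/-- If two corners of the unit square carry tight valid inequalities that can be made almost flat,
then the height is at least one over the edge between them and beyond it. -/
theorem exists_edge_inequality (hK : Convex ℝ K) (hX : IsIntegerForm X) (hY : IsIntegerForm Y)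
    {a₁ a₂ b₁ b₂ : ℝ} (ha₁ : 0 < a₁) (ha₂ : 0 < a₂) (hb₁ : 0 < b₁) (hb₂ : 0 < b₂)
    (hA : EventuallyOnClosures K fun z => 1 ≤ height α z + a₁ * X z + a₂ * Y z)
    (hB : EventuallyOnClosures K fun z => 1 ≤ height α z + b₁ * (1 - X z) + b₂ * Y z)
    {κ C : ℝ} (hκ : 0 < κ) (hgrow : EventuallyOnClosures K fun z => κ * |X z| - C ≤ height α z)
    (hdef : ∀ ε > 0, EventuallyOnClosures K fun z => 1 - ε ≤ height α z) :
    ∃ M ≥ 0, EventuallyOnClosures K fun z => 1 ≤ height α z + M * Y z := by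
  obtain ⟨M, hM⟩ : ∃ M, M = min a₂ b₂ := ⟨_, rfl⟩
  have hM0 : 0 < M := hM ▸ lt_min ha₂ hb₂
  have hMa : M ≤ a₂ := hM ▸ min_le_left _ _
  have hMb : M ≤ b₂ := hM ▸ min_le_right _ _
  -- The factor 2 keeps `ρ < 1` even when `s = M`.
  have hρ : ∀ {s : ℝ}, M ≤ s → 0 < M / (2 * s) ∧ M / (2 * s) < 1 ∧ M / (2 * s) * s ≤ M := by
    intro s hs
    have hs0 : 0 < s := by linarith
    refine ⟨by positivity, ?_, ?_⟩
    · rw [div_lt_one (by positivity)]; linarith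
    · have : M / (2 * s) * s = M / 2 := by field_simp
      linarith
  obtain ⟨τ, hτ, h1⟩ := exists_flat_corner hK hX hY ha₁ ha₂ hA hκ hgrow hdef (hρ hMa).1 (hρ hMa).2.1
  have hgrow' : EventuallyOnClosures K fun z => κ * |1 - X z| - (C + κ) ≤ height α z := by
    refine hgrow.mono fun z hz => ?_
    have : κ * |1 - X z| ≤ κ * (1 + |X z|) := by
      gcongr
      simpa using abs_sub (1 : ℝ) (X z)
    linarith
  obtain ⟨σ, hσ, h2⟩ := exists_flat_corner hK hX.one_sub hY hb₁ hb₂ hB hκ hgrow' hdef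
    (hρ hMb).1 (hρ hMb).2.1
  refine ⟨M, hM0.le, ?_⟩
  have := EventuallyOnClosures.of_split (α := α) (c := 1) (u := 0) (v := M)
    hX hY hX (((hA.and hK hB).and hK (h1.and hK h2)).mono ?_)
  · exact this.mono fun z hz => by linarith
  · rintro z ⟨⟨h1, h2⟩, h3, h4⟩ hW
    -- Below the edge the original slope, at least `M`, is the useful one; above it the flattened
    -- slope, at most `M`.
    rcases hW with hW | hW <;> rcases le_total (Y z) 0 with hy | hy
    · nlinarith
    · have := mul_le_mul_of_nonneg_right (hρ hMa).2.2 hy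
      nlinarith
    · nlinarith
    · have := mul_le_mul_of_nonneg_right (hρ hMb).2.2 hy
      nlinarith

/-- Inequalities that are tight at height one over the corners of the unit square, and strictly
lower over the adjacent corners, yield the inequality `height ≥ 1` after finitely many split
closures. -/
theorem eventually_one_le_height (hK : Convex ℝ K) (hX : IsIntegerForm X) (hY : IsIntegerForm Y)
    {a₁ a₂ b₁ b₂ c₁ c₂ d₁ d₂ : ℝ} (ha₁ : 0 < a₁) (ha₂ : 0 < a₂) (hb₁ : 0 < b₁) (hb₂ : 0 < b₂)
    (hc₁ : 0 < c₁) (hc₂ : 0 < c₂) (hd₁ : 0 < d₁) (hd₂ : 0 < d₂)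
    (h0 : ∀ z ∈ K, 0 ≤ height α z)
    (hA : ∀ z ∈ K, 1 ≤ height α z + a₁ * X z + a₂ * Y z)
    (hB : ∀ z ∈ K, 1 ≤ height α z + b₁ * (1 - X z) + b₂ * Y z)
    (hC : ∀ z ∈ K, 1 ≤ height α z + c₁ * (1 - X z) + c₂ * (1 - Y z))
    (hD : ∀ z ∈ K, 1 ≤ height α z + d₁ * X z + d₂ * (1 - Y z)) :
    EventuallyOnClosures K fun z => 1 ≤ height α z := by
  replace hA := EventuallyOnClosures.of_forall_mem hA
  replace hB := EventuallyOnClosures.of_forall_mem hB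
  replace hC := EventuallyOnClosures.of_forall_mem hC
  replace hD := EventuallyOnClosures.of_forall_mem hD
  have hdef : ∀ ε > 0, EventuallyOnClosures K fun z => 1 - ε ≤ height α z := by
    obtain ⟨θ, hθ0, hθ1, M, hM, h1⟩ :=
      exists_edge_contraction hK hX hY ha₁ ha₂ hb₁ hb₂ hA hB
    obtain ⟨η, hη0, hη1, N, hN, h2⟩ :=
      exists_edge_contraction hK hX hY.one_sub hd₁ hd₂ hc₁ hc₂ hD hC
    obtain ⟨r, hr⟩ : ∃ r, r = max θ η := ⟨_, rfl⟩
    have hr1 : r < 1 := hr ▸ max_lt hθ1 hη1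
    have hθr : θ ≤ r := hr ▸ le_max_left _ _
    have hηr : η ≤ r := hr ▸ le_max_right _ _
    have hr0 : 0 ≤ r := hθ0.trans hθr
    have hpow : ∀ n : ℕ, EventuallyOnClosures K fun z => 1 - r ^ n ≤ height α z := by
      intro n
      induction n with
      | zero => exact (EventuallyOnClosures.of_forall_mem h0).mono fun z hz => by simpa using hz
      | succ n ih =>
        have hrn : 0 ≤ r ^ n := pow_nonneg hr0 n
        have := EventuallyOnClosures.of_split (α := α) (c := 1 - r ^ (n + 1)) (u := 0) (v := 0)
          hX hY hY (((h1 _ hrn ih).and hK (h2 _ hrn ih)).mono ?_)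
        · exact this.mono fun z hz => by linarith
        · rintro z ⟨h3, h4⟩ hW
          have h5 : θ * r ^ n ≤ r * r ^ n := by gcongr
          have h6 : η * r ^ n ≤ r * r ^ n := by gcongr
          rw [pow_succ']
          rcases hW with hW | hW <;> nlinarith
    intro ε hε
    obtain ⟨n, hn⟩ := exists_pow_lt_of_lt_one hε hr1
    exact (hpow n).mono fun z hz => by linarith
  have hgrow : ∃ κ > 0, ∃ C, EventuallyOnClosures K fun z => κ * |X z| - C ≤ height α z := by
    -- Eliminating `Y` between `hA` and `hD` gives growth for `X ≤ 0`, and between `hB` and `hC` for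
    -- `X ≥ 0`. The last summand of the constant accounts for passing from `X - 1` to `X`.
    refine ⟨min ((d₂ * a₁ + a₂ * d₁) / (a₂ + d₂)) ((c₂ * b₁ + b₂ * c₁) / (b₂ + c₂)), by positivity,
      a₂ * d₂ / (a₂ + d₂) + b₂ * c₂ / (b₂ + c₂) + (c₂ * b₁ + b₂ * c₁) / (b₂ + c₂), ?_⟩
    refine ((hA.and hK hB).and hK (hC.and hK hD)).mono ?_
    rintro z ⟨⟨h1, h2⟩, h3, h4⟩
    have p1 : 0 < a₂ * d₂ / (a₂ + d₂) := by positivity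
    have p2 : 0 < b₂ * c₂ / (b₂ + c₂) := by positivity
    have p3 : 0 < (c₂ * b₁ + b₂ * c₁) / (b₂ + c₂) := by positivity
    rcases le_total (X z) 0 with hx | hx
    · have h5 : -((d₂ * a₁ + a₂ * d₁) / (a₂ + d₂)) * X z - a₂ * d₂ / (a₂ + d₂) ≤ height α z := by
        have : -((d₂ * a₁ + a₂ * d₁) / (a₂ + d₂)) * X z - a₂ * d₂ / (a₂ + d₂) =
          (-(d₂ * a₁ + a₂ * d₁) * X z - a₂ * d₂) / (a₂ + d₂) := by ring
        rw [this, div_le_iff₀ (by positivity)]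
        nlinarith
      have h6 := mul_le_mul_of_nonneg_right (min_le_left ((d₂ * a₁ + a₂ * d₁) / (a₂ + d₂))
        ((c₂ * b₁ + b₂ * c₁) / (b₂ + c₂))) (abs_nonneg (X z))
      rw [abs_of_nonpos hx] at h6 ⊢
      linarith
    · have h5 : -((c₂ * b₁ + b₂ * c₁) / (b₂ + c₂)) * (1 - X z) - b₂ * c₂ / (b₂ + c₂) ≤
          height α z := by
        have : -((c₂ * b₁ + b₂ * c₁) / (b₂ + c₂)) * (1 - X z) - b₂ * c₂ / (b₂ + c₂) =
          (-(c₂ * b₁ + b₂ * c₁) * (1 - X z) - b₂ * c₂) / (b₂ + c₂) := by ring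
        rw [this, div_le_iff₀ (by positivity)]
        nlinarith
      have h6 := mul_le_mul_of_nonneg_right (min_le_right ((d₂ * a₁ + a₂ * d₁) / (a₂ + d₂))
        ((c₂ * b₁ + b₂ * c₁) / (b₂ + c₂))) (abs_nonneg (X z))
      rw [abs_of_nonneg hx] at h6 ⊢
      linarith
  obtain ⟨κ, hκ, C, hgrow⟩ := hgrow
  obtain ⟨M, hM, h1⟩ :=
    exists_edge_inequality hK hX hY ha₁ ha₂ hb₁ hb₂ hA hB hκ hgrow hdef
  obtain ⟨N, hN, h2⟩ :=
    exists_edge_inequality hK hX hY.one_sub hd₁ hd₂ hc₁ hc₂ hD hC hκ hgrow hdef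
  have := EventuallyOnClosures.of_split (α := α) (c := 1) (u := 0) (v := 0)
    hX hY hY ((h1.and hK h2).mono ?_)
  · exact this.mono fun z hz => by linarith
  · rintro z ⟨h3, h4⟩ hW
    rcases hW with hW | hW <;> nlinarith

end Derivation

/-! ### Orientation determinants and integer points in the plane -/

section Plane

theorem leftTurn_rotate (a b c : Fin 2 → ℝ) : leftTurn b c a = leftTurn a b c := by
  unfold leftTurn; ring

theorem leftTurn_sum {ι : Type*} (s : Finset ι) (a b : Fin 2 → ℝ) (w : ι → ℝ)
    (y : ι → Fin 2 → ℝ) (hw : ∑ j ∈ s, w j = 1) :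
    leftTurn a b (∑ j ∈ s, w j • y j) = ∑ j ∈ s, w j * leftTurn a b (y j) := by
  have h : ∀ i, (∑ j ∈ s, w j • y j) i - a i = ∑ j ∈ s, w j * (y j i - a i) := by
    intro i
    simp only [mul_sub, Finset.sum_sub_distrib, ← Finset.sum_mul, hw, one_mul,
      Finset.sum_apply, Pi.smul_apply, smul_eq_mul]
  simp only [leftTurn, h, Finset.mul_sum, ← Finset.sum_sub_distrib]
  exact Finset.sum_congr rfl fun _ _ => by ring

theorem leftTurn_combo (a b x y : Fin 2 → ℝ) {s t : ℝ} (hst : s + t = 1) :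
    leftTurn a b (s • x + t • y) = s * leftTurn a b x + t * leftTurn a b y := by
  obtain rfl : s = 1 - t := by linarith
  simp only [leftTurn, Pi.add_apply, Pi.smul_apply, smul_eq_mul]
  ring

theorem convex_leftTurn_nonneg (a b : Fin 2 → ℝ) : Convex ℝ {x | 0 ≤ leftTurn a b x} := by
  intro x hx y hy s t hs ht hst
  simp only [Set.mem_ofPred_eq] at hx hy ⊢
  rw [leftTurn_combo a b x y hst]
  positivity

theorem mem_convexHull_of_leftTurn_nonneg {S : Set (Fin 2 → ℝ)} {a b c x : Fin 2 → ℝ}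
    (ha : a ∈ S) (hb : b ∈ S) (hc : c ∈ S) (h : 0 < leftTurn a b c) (h₁ : 0 ≤ leftTurn b c x)
    (h₂ : 0 ≤ leftTurn c a x) (h₃ : 0 ≤ leftTurn a b x) : x ∈ convexHull ℝ S := by
  have hsum : leftTurn b c x + leftTurn c a x + leftTurn a b x = leftTurn a b c := by
    unfold leftTurn; ring
  have hx : x = ∑ j, (![leftTurn b c x / leftTurn a b c, leftTurn c a x / leftTurn a b c,
      leftTurn a b x / leftTurn a b c] : Fin 3 → ℝ) j • (![a, b, c] : Fin 3 → Fin 2 → ℝ) j := by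
    simp only [Fin.sum_univ_three, Matrix.cons_val]
    ext i
    simp only [Pi.add_apply, Pi.smul_apply, smul_eq_mul]
    field_simp
    unfold leftTurn
    fin_cases i <;> simp <;> ring
  rw [hx]
  refine (convex_convexHull ℝ S).sum_mem ?_ ?_ ?_
  · intro j _; fin_cases j <;> simp <;> positivity
  · simp only [Fin.sum_univ_three, Matrix.cons_val]
    field_simp
    exact hsum
  · intro j _; apply subset_convexHull; fin_cases j <;> simpa

theorem exists_combo_of_leftTurn_eq_zero {a b x : Fin 2 → ℝ} (hab : a ≠ b)
    (h : leftTurn a b x = 0) : ∃ c : ℝ, x = a + c • (b - a) := by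
  have hn : 0 < (b 0 - a 0) ^ 2 + (b 1 - a 1) ^ 2 := by
    by_contra! hle
    refine hab ?_
    have h0 : b 0 - a 0 = 0 := by nlinarith [sq_nonneg (b 0 - a 0), sq_nonneg (b 1 - a 1)]
    have h1 : b 1 - a 1 = 0 := by nlinarith [sq_nonneg (b 0 - a 0), sq_nonneg (b 1 - a 1)]
    ext i
    fin_cases i <;> simp <;> linarith
  unfold leftTurn at h
  -- The parameter of the orthogonal projection onto the line through `a` and `b`.
  refine ⟨((x 0 - a 0) * (b 0 - a 0) + (x 1 - a 1) * (b 1 - a 1)) /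
    ((b 0 - a 0) ^ 2 + (b 1 - a 1) ^ 2), ?_⟩
  ext i
  simp only [Pi.add_apply, Pi.smul_apply, Pi.sub_apply, smul_eq_mul]
  rw [div_mul_eq_mul_div, ← sub_eq_iff_eq_add', eq_div_iff hn.ne']
  fin_cases i <;> simp
  · linear_combination -(b 1 - a 1) * h
  · linear_combination (b 0 - a 0) * h

theorem integerPoints_add {x y : Fin 2 → ℝ} (hx : x ∈ integerPoints) (hy : y ∈ integerPoints) :
    x + y ∈ integerPoints := fun i => by
  obtain ⟨m, hm⟩ := hx i
  obtain ⟨n, hn⟩ := hy i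
  exact ⟨m + n, by simp [hm, hn]⟩

theorem integerPoints_sub {x y : Fin 2 → ℝ} (hx : x ∈ integerPoints) (hy : y ∈ integerPoints) :
    x - y ∈ integerPoints := fun i => by
  obtain ⟨m, hm⟩ := hx i
  obtain ⟨n, hn⟩ := hy i
  exact ⟨m - n, by simp [hm, hn]⟩

theorem integerPoints_intCast_smul {x : Fin 2 → ℝ} (m : ℤ) (hx : x ∈ integerPoints) :
    (m : ℝ) • x ∈ integerPoints := fun i => by
  obtain ⟨n, hn⟩ := hx i
  exact ⟨m * n, by simp [hn]⟩

end Plane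

/-! ### Convex quadrilaterals and points on their sides -/

section Quadrilateral

variable {v : Fin 4 → Fin 2 → ℝ}

theorem leftTurn_vertex_nonneg (hv : ∀ i, 0 < leftTurn (v i) (v (i + 1)) (v (i + 2)))
    (i : Fin 4) {x : Fin 2 → ℝ} (hx : x ∈ convexHull ℝ (Set.range v)) :
    0 ≤ leftTurn (v i) (v (i + 1)) x := by
  refine convexHull_min ?_ (convex_leftTurn_nonneg _ _) hx
  rintro _ ⟨j, rfl⟩
  have h3 := hv (i + 3)
  rw [show i + 3 + 1 = i by grind, show i + 3 + 2 = i + 1 by grind, ← leftTurn_rotate] at h3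
  have hj : j = i ∨ j = i + 1 ∨ j = i + 2 ∨ j = i + 3 := by grind
  simp only [Set.mem_ofPred_eq]
  rcases hj with rfl | rfl | rfl | rfl
  · exact le_of_eq (by unfold leftTurn; ring)
  · exact le_of_eq (by unfold leftTurn; ring)
  · exact (hv i).le
  · exact h3.le

theorem mem_interior_convexHull_of_leftTurn_pos
    (hv : ∀ i, 0 < leftTurn (v i) (v (i + 1)) (v (i + 2))) {x : Fin 2 → ℝ}
    (hx : ∀ i, 0 < leftTurn (v i) (v (i + 1)) x) : x ∈ interior (convexHull ℝ (Set.range v)) := by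
  have hopen : IsOpen {x | ∀ i, 0 < leftTurn (v i) (v (i + 1)) x} := by
    simp only [Set.ofPred_forall]
    refine isOpen_iInter_of_finite fun i => isOpen_lt continuous_const ?_
    unfold leftTurn
    fun_prop
  refine interior_maximal ?_ hopen hx
  intro z hz
  have h0 := hz 0
  have h1 := hz 1
  have h2 := hz 2
  have h3 := hz 3
  -- The diagonal from `v 0` to `v 2` cuts the quadrilateral into two triangles.
  rcases le_total (leftTurn (v 0) (v 2) z) 0 with h | h
  · refine mem_convexHull_of_leftTurn_nonneg (a := v 0) (b := v 1) (c := v 2) ⟨_, rfl⟩ ⟨_, rfl⟩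
      ⟨_, rfl⟩ (hv 0) h1.le ?_ h0.le
    have : leftTurn (v 2) (v 0) z = -leftTurn (v 0) (v 2) z := by unfold leftTurn; ring
    linarith
  · exact mem_convexHull_of_leftTurn_nonneg (a := v 2) (b := v 3) (c := v 0) ⟨_, rfl⟩ ⟨_, rfl⟩
      ⟨_, rfl⟩ (hv 2) h3.le h h2.le

variable {y : Fin 4 → Fin 2 → ℝ}

theorem leftTurn_side_eq_zero (hy : ∀ i, y i ∈ openSegment ℝ (v i) (v (i + 1))) (i : Fin 4) :
    leftTurn (v i) (v (i + 1)) (y i) = 0 := by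
  obtain ⟨s, t, hs, ht, hst, hyi⟩ := hy i
  rw [← hyi, leftTurn_combo _ _ _ _ hst]
  unfold leftTurn; ring

theorem leftTurn_side_pos (hv : ∀ i, 0 < leftTurn (v i) (v (i + 1)) (v (i + 2)))
    (hy : ∀ i, y i ∈ openSegment ℝ (v i) (v (i + 1))) {i j : Fin 4} (hij : j ≠ i) :
    0 < leftTurn (v i) (v (i + 1)) (y j) := by
  have h2 := hv i
  have h3 := hv (i + 3)
  rw [show i + 3 + 1 = i by grind, show i + 3 + 2 = i + 1 by grind, ← leftTurn_rotate] at h3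
  have h0 : leftTurn (v i) (v (i + 1)) (v i) = 0 := by unfold leftTurn; ring
  have h1 : leftTurn (v i) (v (i + 1)) (v (i + 1)) = 0 := by unfold leftTurn; ring
  have hj : j = i + 1 ∨ j = i + 2 ∨ j = i + 3 := by grind
  obtain ⟨s, t, hs, ht, hst, hyj⟩ := hy j
  rw [← hyj, leftTurn_combo _ _ _ _ hst]
  rcases hj with rfl | rfl | rfl
  · rw [show i + 1 + 1 = i + 2 by grind, h1]; positivity
  · rw [show i + 2 + 1 = i + 3 by grind]; positivity
  · rw [show i + 3 + 1 = i by grind, h0]; positivity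

/-- Expand the determinant multi-affinely in the three points. Terms with a repeated vertex vanish;
the other four are positively oriented vertex triples. -/
theorem leftTurn_sides_pos (hv : ∀ i, 0 < leftTurn (v i) (v (i + 1)) (v (i + 2)))
    (hy : ∀ i, y i ∈ openSegment ℝ (v i) (v (i + 1))) (i : Fin 4) :
    0 < leftTurn (y i) (y (i + 1)) (y (i + 2)) := by
  have h0 := hv i
  have h1 := hv (i + 1)
  have h2 := hv (i + 2)
  have h3 := hv (i + 3)
  rw [show i + 1 + 1 = i + 2 by grind, show i + 1 + 2 = i + 3 by grind] at h1
  rw [show i + 2 + 1 = i + 3 by grind, show i + 2 + 2 = i by grind, leftTurn_rotate] at h2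
  rw [show i + 3 + 1 = i by grind, show i + 3 + 2 = i + 1 by grind, ← leftTurn_rotate] at h3
  obtain ⟨s₀, t₀, hs₀, ht₀, hst₀, hy₀⟩ := hy i
  obtain ⟨s₁, t₁, hs₁, ht₁, hst₁, hy₁⟩ := hy (i + 1)
  obtain ⟨s₂, t₂, hs₂, ht₂, hst₂, hy₂⟩ := hy (i + 2)
  rw [show i + 1 + 1 = i + 2 by grind] at hy₁
  rw [show i + 2 + 1 = i + 3 by grind] at hy₂
  have key : leftTurn (y i) (y (i + 1)) (y (i + 2)) =
      s₀ * s₁ * s₂ * leftTurn (v i) (v (i + 1)) (v (i + 2)) +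
      s₀ * s₁ * t₂ * leftTurn (v i) (v (i + 1)) (v (i + 3)) +
      s₀ * t₁ * t₂ * leftTurn (v i) (v (i + 2)) (v (i + 3)) +
      t₀ * t₁ * t₂ * leftTurn (v (i + 1)) (v (i + 2)) (v (i + 3)) := by
    obtain rfl : s₀ = 1 - t₀ := by linarith
    obtain rfl : s₁ = 1 - t₁ := by linarith
    obtain rfl : s₂ = 1 - t₂ := by linarith
    rw [← hy₀, ← hy₁, ← hy₂]
    simp only [leftTurn, Pi.add_apply, Pi.smul_apply, smul_eq_mul]
    ring
  rw [key]
  positivity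

end Quadrilateral

/-! ### The side points as a lattice parallelogram -/

section Lattice

theorem isIntegerForm_of_integral {k : ℕ} {φ : (Fin 2 → ℝ) → ℝ}
    (haff : ∀ x, φ x = φ 0 + x 0 * (φ ![1, 0] - φ 0) + x 1 * (φ ![0, 1] - φ 0))
    (hint : ∀ x ∈ integerPoints, ∃ n : ℤ, φ x = n) :
    IsIntegerForm fun z : (Fin 2 → ℝ) × (Fin k → ℝ) => φ z.1 := by
  obtain ⟨c, hc⟩ := hint 0 fun i => ⟨0, by simp⟩
  obtain ⟨a, ha⟩ := hint ![1, 0] fun i => by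
    fin_cases i
    · exact ⟨1, by simp⟩
    · exact ⟨0, by simp⟩
  obtain ⟨b, hb⟩ := hint ![0, 1] fun i => by
    fin_cases i
    · exact ⟨0, by simp⟩
    · exact ⟨1, by simp⟩
  refine ⟨![a - c, b - c], c, fun z => ?_⟩
  change φ z.1 = _
  rw [haff, ha, hb, hc]
  simp [Fin.sum_univ_two]
  ring

variable {v y : Fin 4 → Fin 2 → ℝ}

/-- No weight is 1, so for each side some positive weight sits on a point off that side. The
combination is therefore strictly inside all four sides. -/
theorem sum_side_points_notMem_integerPoints
    (hv : ∀ i, 0 < leftTurn (v i) (v (i + 1)) (v (i + 2)))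
    (hy : ∀ i, y i ∈ openSegment ℝ (v i) (v (i + 1)))
    (hfree : ∀ x ∈ integerPoints, ¬∀ i, 0 < leftTurn (v i) (v (i + 1)) x)
    {w : Fin 4 → ℝ} (hw : ∀ j, 0 ≤ w j) (hw1 : ∑ j, w j = 1) (hlt : ∀ j, w j < 1) :
    ∑ j, w j • y j ∉ integerPoints := by
  refine fun hmem => hfree _ hmem fun i => ?_
  rw [leftTurn_sum _ _ _ _ _ hw1]
  have hnn : ∀ j, 0 ≤ leftTurn (v i) (v (i + 1)) (y j) := by
    intro j
    rcases eq_or_ne j i with rfl | hj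
    · exact (leftTurn_side_eq_zero hy j).ge
    · exact (leftTurn_side_pos hv hy hj).le
  obtain ⟨j, hji, hj⟩ : ∃ j, j ≠ i ∧ 0 < w j := by
    by_contra! hcon
    rw [Finset.sum_eq_single i (fun j _ hj => le_antisymm (hcon j hj) (hw j)) (by simp)] at hw1
    exact (hlt i).ne hw1
  exact Finset.sum_pos' (fun j _ => mul_nonneg (hw j) (hnn j))
    ⟨j, Finset.mem_univ j, mul_pos hj (leftTurn_side_pos hv hy hji)⟩

theorem eq_add_leftTurn_smul {a b c : Fin 2 → ℝ} (h : leftTurn a b c ≠ 0) (x : Fin 2 → ℝ) :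
    x = a + (leftTurn a x c / leftTurn a b c) • (b - a) +
      (leftTurn a b x / leftTurn a b c) • (c - a) := by
  ext i
  simp only [Pi.add_apply, Pi.smul_apply, Pi.sub_apply, smul_eq_mul]
  field_simp
  unfold leftTurn
  fin_cases i <;> simp <;> ring

/-- The integer points on the sides of a lattice-free quadrilateral span the lattice: the
coordinates of an integer point with respect to them are integers. -/
theorem exists_int_coordinates (hv : ∀ i, 0 < leftTurn (v i) (v (i + 1)) (v (i + 2)))
    (hy : ∀ i, y i ∈ openSegment ℝ (v i) (v (i + 1))) (hyint : ∀ i, y i ∈ integerPoints)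
    (hfree : ∀ x ∈ integerPoints, ¬∀ i, 0 < leftTurn (v i) (v (i + 1)) x)
    {ξ η : ℝ} (h : y 0 + ξ • (y 1 - y 0) + η • (y 3 - y 0) ∈ integerPoints) :
    (∃ m : ℤ, ξ = m) ∧ ∃ n : ℤ, η = n := by
  obtain ⟨s, hs⟩ : ∃ s, s = Int.fract ξ := ⟨_, rfl⟩
  obtain ⟨t, ht⟩ : ∃ t, t = Int.fract η := ⟨_, rfl⟩
  have hs0 : 0 ≤ s := hs ▸ Int.fract_nonneg ξ
  have ht0 : 0 ≤ t := ht ▸ Int.fract_nonneg η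
  have hs1 : s < 1 := hs ▸ Int.fract_lt_one ξ
  have ht1 : t < 1 := ht ▸ Int.fract_lt_one η
  have hξ : ξ = ⌊ξ⌋ + s := by rw [hs, Int.floor_add_fract]
  have hη : η = ⌊η⌋ + t := by rw [ht, Int.floor_add_fract]
  have hz : y 0 + s • (y 1 - y 0) + t • (y 3 - y 0) ∈ integerPoints := by
    have := integerPoints_sub (integerPoints_sub h
      (integerPoints_intCast_smul ⌊ξ⌋ (integerPoints_sub (hyint 1) (hyint 0))))
      (integerPoints_intCast_smul ⌊η⌋ (integerPoints_sub (hyint 3) (hyint 0)))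
    convert this using 1
    conv_rhs => rw [hξ, hη]
    have e1 : (⌊(⌊ξ⌋ : ℝ) + s⌋ : ℤ) = ⌊ξ⌋ := by rw [← hξ]
    have e2 : (⌊(⌊η⌋ : ℝ) + t⌋ : ℤ) = ⌊η⌋ := by rw [← hη]
    rw [e1, e2]
    module
  have hst : s = 0 ∧ t = 0 := by
    -- The reduced point lies in the triangle `y 0, y 1, y 3`, or else its reflection `y 1 + y 3 -
    -- z` does.
    rcases le_or_gt (s + t) 1 with hle | hgt
    · by_contra hne
      have hpos : 0 < s + t := by
        rcases hs0.lt_or_eq with h0 | h0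
        · linarith
        · rcases ht0.lt_or_eq with h1 | h1
          · linarith
          · exact absurd ⟨h0.symm, h1.symm⟩ hne
      refine sum_side_points_notMem_integerPoints hv hy hfree (w := ![1 - s - t, s, 0, t])
        ?_ ?_ ?_ ?_
      · intro j; fin_cases j <;> simp <;> linarith
      · simp only [Fin.sum_univ_four, Matrix.cons_val]
        ring
      · intro j; fin_cases j <;> simp <;> linarith
      · convert hz using 1
        simp only [Fin.sum_univ_four, Matrix.cons_val]
        module
    · exfalso
      refine sum_side_points_notMem_integerPoints hv hy hfree (w := ![s + t - 1, 1 - s, 0, 1 - t])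
        ?_ ?_ ?_ ?_
      · intro j; fin_cases j <;> simp <;> linarith
      · simp only [Fin.sum_univ_four, Matrix.cons_val]
        ring
      · intro j; fin_cases j <;> simp <;> linarith
      · convert integerPoints_sub (integerPoints_add (hyint 1) (hyint 3)) hz using 1
        simp only [Fin.sum_univ_four, Matrix.cons_val]
        module
  exact ⟨⟨⌊ξ⌋, by rw [hst.1, add_zero] at hξ; exact hξ⟩,
    ⟨⌊η⌋, by rw [hst.2, add_zero] at hη; exact hη⟩⟩

/-- The integer points on the sides of a lattice-free quadrilateral form a parallelogram. -/
theorem side_points_parallelogram (hv : ∀ i, 0 < leftTurn (v i) (v (i + 1)) (v (i + 2)))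
    (hy : ∀ i, y i ∈ openSegment ℝ (v i) (v (i + 1))) (hyint : ∀ i, y i ∈ integerPoints)
    (hfree : ∀ x ∈ integerPoints, ¬∀ i, 0 < leftTurn (v i) (v (i + 1)) x) :
    y 0 + y 2 = y 1 + y 3 := by
  have hΔ : 0 < leftTurn (y 0) (y 1) (y 3) := by
    rw [← leftTurn_rotate, ← leftTurn_rotate]; exact leftTurn_sides_pos hv hy 3
  have h2 := eq_add_leftTurn_smul hΔ.ne' (y 2)
  have hm0 : 0 < leftTurn (y 0) (y 2) (y 3) / leftTurn (y 0) (y 1) (y 3) :=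
    div_pos (by rw [← leftTurn_rotate]; exact leftTurn_sides_pos hv hy 2) hΔ
  have hn0 : 0 < leftTurn (y 0) (y 1) (y 2) / leftTurn (y 0) (y 1) (y 3) :=
    div_pos (leftTurn_sides_pos hv hy 0) hΔ
  obtain ⟨⟨m, hm⟩, n, hn⟩ := exists_int_coordinates hv hy hyint hfree (h2 ▸ hyint 2)
  rw [hm] at h2 hm0
  rw [hn] at h2 hn0
  have hm1 : (1 : ℝ) ≤ m := by exact_mod_cast hm0
  have hn1 : (1 : ℝ) ≤ n := by exact_mod_cast hn0
  have hw := integerPoints_sub (integerPoints_add (hyint 1) (hyint 3)) (hyint 0)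
  -- Unless `m = n = 1`, the integer point `y 1 + y 3 - y 0` is a convex combination of side points
  -- with all weights below 1, which is impossible.
  by_cases hmn : m = 1 ∧ n = 1
  · rw [hmn.1, hmn.2] at h2
    rw [h2]
    simp only [Int.cast_one]
    module
  exfalso
  rcases le_total n m with hle | hle
  · have hlt : (1 : ℝ) < m := by
      have : 1 < m := by
        have : 0 < m := by exact_mod_cast hm0
        have : 0 < n := by exact_mod_cast hn0
        omega
      exact_mod_cast this
    have hle' : (n : ℝ) ≤ m := by exact_mod_cast hle
    have hm' : (0 : ℝ) < m := by linarith
    refine sum_side_points_notMem_integerPoints hv hy hfree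
      (w := ![(n - 1) / m, 0, 1 / m, (m - n) / m]) ?_ ?_ ?_ ?_
    · intro j
      fin_cases j <;> simp only [Fin.mk_one, Fin.zero_eta, Fin.reduceFinMk, Matrix.cons_val,
        le_refl] <;> exact div_nonneg (by linarith) (by linarith)
    · simp only [Fin.sum_univ_four, Matrix.cons_val]
      field_simp
      ring
    · intro j
      fin_cases j <;> simp only [Fin.mk_one, Fin.zero_eta, Fin.reduceFinMk, Matrix.cons_val,
        div_lt_one hm'] <;> linarith
    · convert hw using 1
      simp only [Fin.sum_univ_four, Matrix.cons_val]
      conv_lhs => rw [h2]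
      match_scalars <;> field_simp <;> ring
  · have hlt : (1 : ℝ) < n := by
      have : 1 < n := by
        have : 0 < m := by exact_mod_cast hm0
        have : 0 < n := by exact_mod_cast hn0
        omega
      exact_mod_cast this
    have hle' : (m : ℝ) ≤ n := by exact_mod_cast hle
    have hn' : (0 : ℝ) < n := by linarith
    refine sum_side_points_notMem_integerPoints hv hy hfree
      (w := ![(m - 1) / n, (n - m) / n, 1 / n, 0]) ?_ ?_ ?_ ?_
    · intro j
      fin_cases j <;> simp only [Fin.mk_one, Fin.zero_eta, Fin.reduceFinMk, Matrix.cons_val,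
        le_refl] <;> exact div_nonneg (by linarith) (by linarith)
    · simp only [Fin.sum_univ_four, Matrix.cons_val]
      field_simp
      ring
    · intro j
      fin_cases j <;> simp only [Fin.mk_one, Fin.zero_eta, Fin.reduceFinMk, Matrix.cons_val,
        div_lt_one hn'] <;> linarith
    · convert hw using 1
      simp only [Fin.sum_univ_four, Matrix.cons_val]
      conv_lhs => rw [h2]
      match_scalars <;> field_simp <;> ring

end Lattice

/-! ### Inequalities read off from the induced set -/

section InducedSet

variable {k : ℕ} {R : Matrix (Fin 2) (Fin k) ℚ} {f : Fin 2 → ℚ} {α : Fin k → ℝ}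

theorem convex_relaxation (R : Matrix (Fin 2) (Fin k) ℚ) (f : Fin 2 → ℚ) :
    Convex ℝ (relaxation R f) := by
  rintro ⟨x, s⟩ ⟨hs, hx⟩ ⟨y, t⟩ ⟨ht, hy⟩ a b ha hb hab
  refine ⟨fun j => ?_, ?_⟩
  · have := hs j
    have := ht j
    simp only [Prod.snd_add, Prod.smul_snd, Pi.add_apply, Pi.smul_apply, smul_eq_mul] at *
    positivity
  · simp only at hx hy
    simp only [Prod.fst_add, Prod.smul_fst, Prod.snd_add, Prod.smul_snd, Pi.add_apply,
      Pi.smul_apply, smul_eq_mul, add_smul, mul_smul, Finset.sum_add_distrib, ← Finset.smul_sum,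
      hx, hy, smul_add]
    obtain rfl : a = 1 - b := by linarith
    module

/-- Points of `L_α` lift to points of the relaxation of height at most 1; cone directions cost no
height. -/
theorem exists_repr_of_mem_inducedSet {q : Fin 2 → ℝ} (hq : q ∈ inducedSet R f α) :
    ∃ s : Fin k → ℝ, (∀ j, 0 ≤ s j) ∧ ∑ j, α j * s j ≤ 1 ∧
      q = realPoint f + ∑ j, s j • column R j := by
  obtain ⟨u, hu, d, ⟨t, ht, ht0, rfl⟩, rfl⟩ := hq
  suffices h : u ∈ {u | ∃ s : Fin k → ℝ, (∀ j, 0 ≤ s j) ∧ ∑ j, α j * s j ≤ 1 ∧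
      u = realPoint f + ∑ j, s j • column R j} by
    obtain ⟨s, hs, hs1, rfl⟩ := h
    refine ⟨s + t, fun j => add_nonneg (hs j) (ht j), ?_, ?_⟩
    · have h0 : ∀ j, α j * t j = 0 := fun j => by
        rcases eq_or_ne (α j) 0 with h | h
        · rw [h, zero_mul]
        · rw [ht0 j h, mul_zero]
      simpa [mul_add, h0] using hs1
    · simp only [Pi.add_apply, add_smul, Finset.sum_add_distrib, add_assoc]
  refine convexHull_min ?_ ?_ hu
  · rintro p (⟨j, hj, rfl⟩ | rfl)
    · refine ⟨Pi.single j (1 / α j), fun i => ?_, ?_, ?_⟩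
      · have : (0 : Fin k → ℝ) ≤ Pi.single j (1 / α j) := Pi.single_nonneg.2 (by positivity)
        exact this i
      · simp [Pi.single_apply, hj.ne']
      · simp [Pi.single_apply]
    · exact ⟨0, by simp, by simp, by simp⟩
  · rintro x ⟨s, hs, hs1, rfl⟩ y ⟨t, ht, ht1, rfl⟩ a b ha hb hab
    refine ⟨fun j => a * s j + b * t j, fun j => ?_, ?_, ?_⟩
    · have := hs j
      have := ht j
      positivity
    · calc ∑ j, α j * (a * s j + b * t j) = a * ∑ j, α j * s j + b * ∑ j, α j * t j := by
            rw [Finset.mul_sum, Finset.mul_sum, ← Finset.sum_add_distrib]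
            exact Finset.sum_congr rfl fun _ _ => by ring
        _ ≤ a * 1 + b * 1 := by gcongr
        _ = 1 := by linarith
    · simp only [add_smul, mul_smul, Finset.sum_add_distrib, ← Finset.smul_sum]
      obtain rfl : a = 1 - b := by linarith
      module

/-- No integer point lies on a segment from `f` into the induced set of a valid inequality, except
possibly at its far end. -/
theorem lineMap_notMem_integerPoints
    (hvalid : IsValidInequality (convexHull ℝ (mixedIntegerSet R f)) α 1) {q : Fin 2 → ℝ}
    (hq : q ∈ inducedSet R f α) {t : ℝ} (ht0 : 0 ≤ t) (ht1 : t < 1) :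
    realPoint f + t • (q - realPoint f) ∉ integerPoints := by
  intro hint
  obtain ⟨s, hs, hs1, rfl⟩ := exists_repr_of_mem_inducedSet hq
  -- Scaling the lift by `t` would give a point of `P(R,f)` of height at most `t < 1`.
  have hmem : (realPoint f + t • (realPoint f + ∑ j, s j • column R j - realPoint f), t • s) ∈
      mixedIntegerSet R f := by
    refine ⟨⟨fun j => mul_nonneg ht0 (hs j), ?_⟩, hint⟩
    simp [Finset.smul_sum, mul_smul]
  have h := hvalid _ (subset_convexHull ℝ _ hmem)
  have h2 : ∑ j, α j * (t • s) j = t * ∑ j, α j * s j := by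
    rw [Finset.mul_sum]
    exact Finset.sum_congr rfl fun _ _ => by simp only [Pi.smul_apply, smul_eq_mul]; ring
  rw [h2] at h
  nlinarith

theorem realPoint_mem_inducedSet : realPoint f ∈ inducedSet R f α :=
  ⟨realPoint f, subset_convexHull ℝ _ (Or.inr rfl), 0, ⟨0, by simp, by simp, by simp⟩, by simp⟩

theorem realPoint_add_mem_inducedSet_of_pos {j : Fin k} (hj : 0 < α j) :
    realPoint f + (1 / α j) • column R j ∈ inducedSet R f α :=
  ⟨_, subset_convexHull ℝ _ (Or.inl ⟨j, hj, rfl⟩), 0, ⟨0, by simp, by simp, by simp⟩, by simp⟩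

theorem realPoint_add_mem_inducedSet_of_eq_zero {j : Fin k} (hj : α j = 0) {t : ℝ} (ht : 0 ≤ t) :
    realPoint f + t • column R j ∈ inducedSet R f α := by
  refine ⟨realPoint f, subset_convexHull ℝ _ (Or.inr rfl), t • column R j,
    ⟨Pi.single j t, fun i => ?_, fun i hi => ?_, by simp [Pi.single_apply]⟩, rfl⟩
  · have : (0 : Fin k → ℝ) ≤ Pi.single j t := Pi.single_nonneg.2 ht
    exact this i
  · rw [Pi.single_apply, if_neg]
    rintro rfl
    exact hi hj

/-- A half-plane that contains the induced set gives a valid inequality for the relaxation. -/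
theorem leftTurn_le_of_mem_relaxation (hα : ∀ j, 0 ≤ α j) {a b : Fin 2 → ℝ}
    (hab : ∀ x ∈ inducedSet R f α, 0 ≤ leftTurn a b x) {z : (Fin 2 → ℝ) × (Fin k → ℝ)}
    (hz : z ∈ relaxation R f) :
    leftTurn a b (realPoint f) ≤ leftTurn a b (realPoint f) * height α z + leftTurn a b z.1 := by
  obtain ⟨hs, hx⟩ := hz
  obtain ⟨D, hD⟩ : ∃ D : (Fin 2 → ℝ) → ℝ,
      D = fun r => (b 0 - a 0) * r 1 - (b 1 - a 1) * r 0 := ⟨_, rfl⟩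
  have hadd : ∀ r, leftTurn a b (realPoint f + r) = leftTurn a b (realPoint f) + D r := by
    intro r
    simp only [hD, leftTurn, Pi.add_apply]
    ring
  have hsmul : ∀ (t : ℝ) r, D (t • r) = t * D r := by
    intro t r
    simp only [hD, Pi.smul_apply, smul_eq_mul]
    ring
  have hsum : D (∑ j, z.2 j • column R j) = ∑ j, z.2 j * D (column R j) := by
    simp only [hD, Finset.sum_apply, Pi.smul_apply, smul_eq_mul, Finset.mul_sum,
      ← Finset.sum_sub_distrib]
    exact Finset.sum_congr rfl fun _ _ => by ring
  have hcol : ∀ j, 0 ≤ leftTurn a b (realPoint f) * α j + D (column R j) := by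
    intro j
    rcases (hα j).lt_or_eq with hj | hj
    · have := hab _ (realPoint_add_mem_inducedSet_of_pos hj)
      rw [hadd, hsmul] at this
      have h2 := mul_nonneg hj.le this
      have h3 : α j * (leftTurn a b (realPoint f) + 1 / α j * D (column R j)) =
          leftTurn a b (realPoint f) * α j + D (column R j) := by field_simp
      rwa [h3] at h2
    · rw [← hj, mul_zero, zero_add]
      by_contra! hneg
      have h0 := hab _ realPoint_mem_inducedSet
      have := hab _ (realPoint_add_mem_inducedSet_of_eq_zero hj.symm
        -- Far enough along the ray for the determinant to equal `-1`.
        (t := (leftTurn a b (realPoint f) + 1) / -D (column R j))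
        (div_nonneg (by linarith) (by linarith)))
      rw [hadd, hsmul, div_mul_eq_mul_div, div_neg, mul_div_cancel_right₀ _ hneg.ne] at this
      linarith
  rw [hx, hadd, hsum, height, Finset.mul_sum]
  have : 0 ≤ ∑ j, z.2 j * (leftTurn a b (realPoint f) * α j + D (column R j)) :=
    Finset.sum_nonneg fun j _ => mul_nonneg (hs j) (hcol j)
  have h2 : ∑ j, z.2 j * (leftTurn a b (realPoint f) * α j + D (column R j)) =
      ∑ j, leftTurn a b (realPoint f) * (α j * z.2 j) + ∑ j, z.2 j * D (column R j) := by
    rw [← Finset.sum_add_distrib]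
    exact Finset.sum_congr rfl fun _ _ => by ring
  linarith

/-- The point `f` does not lie on a side of the induced set that carries an integer point. -/
theorem leftTurn_realPoint_pos (hf : realPoint f ∉ integerPoints)
    (hvalid : IsValidInequality (convexHull ℝ (mixedIntegerSet R f)) α 1) {a b y : Fin 2 → ℝ}
    (ha : a ∈ inducedSet R f α) (hb : b ∈ inducedSet R f α)
    (hab : ∀ x ∈ inducedSet R f α, 0 ≤ leftTurn a b x) (hne : a ≠ b)
    (hy : y ∈ integerPoints) (hyab : y ∈ openSegment ℝ a b) :
    0 < leftTurn a b (realPoint f) := by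
  refine (hab _ realPoint_mem_inducedSet).lt_of_ne fun h0 => ?_
  obtain ⟨c, hc⟩ := exists_combo_of_leftTurn_eq_zero hne h0.symm
  obtain ⟨s, u, hs, hu, hsu, rfl⟩ := hyab
  obtain rfl : s = 1 - u := by linarith
  -- If `f` were on the side's line, the integer point would equal `f` or lie before the end of a
  -- segment from `f` to one of the endpoints.
  rcases lt_trichotomy c u with h | rfl | h
  · have h1 : 1 - c ≠ 0 := by linarith
    refine lineMap_notMem_integerPoints hvalid hb (t := (u - c) / (1 - c))
      (div_nonneg (by linarith) (by linarith)) ((div_lt_one (by linarith)).2 (by linarith)) ?_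
    convert hy using 1
    rw [hc]
    match_scalars <;> field_simp <;> ring
  · refine hf ?_
    convert hy using 1
    rw [hc]
    module
  · have h1 : c ≠ 0 := by linarith
    refine lineMap_notMem_integerPoints hvalid ha (t := (c - u) / c)
      (div_nonneg (by linarith) (by linarith)) ((div_lt_one (by linarith)).2 (by linarith)) ?_
    convert hy using 1
    rw [hc]
    match_scalars <;> field_simp <;> ring

end InducedSet

/-! ### Assembly in lattice coordinates -/

theorem mainTheorem6 {k : ℕ} (R : Matrix (Fin 2) (Fin k) ℚ) (f : Fin 2 → ℚ)
    (hf : realPoint f ∉ integerPoints)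
    (hR : ∀ j, column R j ≠ 0)
    (α : Fin k → ℝ) (hα : ∀ j, 0 ≤ α j)
    (hvalid : IsValidInequality (convexHull ℝ (mixedIntegerSet R f)) α 1)
    (hQ : IsType2Quadrilateral (inducedSet R f α)) :
    splitRank (relaxation R f) α 1 < ⊤ := by
  obtain ⟨hlf, v, hQv, hv, -, hside⟩ := hQ
  choose y hy using fun i => (hside i).exists
  have hyint : ∀ i, y i ∈ integerPoints := fun i => (hy i).1
  replace hy : ∀ i, y i ∈ openSegment ℝ (v i) (v (i + 1)) := fun i => (hy i).2
  have hfree : ∀ x ∈ integerPoints, ¬∀ i, 0 < leftTurn (v i) (v (i + 1)) x := fun x hx hpos =>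
    Set.disjoint_left.1 hlf (hQv ▸ mem_interior_convexHull_of_leftTurn_pos hv hpos) hx
  have hvert : ∀ i, v i ∈ inducedSet R f α := fun i =>
    hQv ▸ subset_convexHull ℝ _ (Set.mem_range_self i)
  have hnonneg : ∀ i, ∀ x ∈ inducedSet R f α, 0 ≤ leftTurn (v i) (v (i + 1)) x := fun i x hx =>
    leftTurn_vertex_nonneg hv i (hQv ▸ hx)
  have hG : ∀ i, 0 < leftTurn (v i) (v (i + 1)) (realPoint f) := fun i => by
    refine leftTurn_realPoint_pos hf hvalid (hvert i) (hvert (i + 1)) (hnonneg i) (fun h => ?_)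
      (hyint i) (hy i)
    have := hv i
    rw [← h] at this
    simp [leftTurn] at this
  have hpar := side_points_parallelogram hv hy hyint hfree
  have hΔ : 0 < leftTurn (y 0) (y 1) (y 3) := by
    rw [← leftTurn_rotate, ← leftTurn_rotate]; exact leftTurn_sides_pos hv hy 3
  -- Cramer coordinates with origin `y 0` and basis `y 1 - y 0`, `y 3 - y 0`.
  obtain ⟨ξ, hξ⟩ : ∃ ξ : (Fin 2 → ℝ) → ℝ,
      ξ = fun x => leftTurn (y 0) x (y 3) / leftTurn (y 0) (y 1) (y 3) := ⟨_, rfl⟩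
  obtain ⟨η, hη⟩ : ∃ η : (Fin 2 → ℝ) → ℝ,
      η = fun x => leftTurn (y 0) (y 1) x / leftTurn (y 0) (y 1) (y 3) := ⟨_, rfl⟩
  have hcoord : ∀ x, x = y 0 + ξ x • (y 1 - y 0) + η x • (y 3 - y 0) := fun x => by
    rw [hξ, hη]; exact eq_add_leftTurn_smul hΔ.ne' x
  have hint : ∀ x ∈ integerPoints, (∃ m : ℤ, ξ x = m) ∧ ∃ n : ℤ, η x = n := fun x hx =>
    exists_int_coordinates hv hy hyint hfree (hcoord x ▸ hx)
  have hX : IsIntegerForm fun z : (Fin 2 → ℝ) × (Fin k → ℝ) => ξ z.1 :=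
    isIntegerForm_of_integral (fun x => by simp [hξ, leftTurn]; ring) fun x hx => (hint x hx).1
  have hY : IsIntegerForm fun z : (Fin 2 → ℝ) × (Fin k → ℝ) => η z.1 :=
    isIntegerForm_of_integral (fun x => by simp [hη, leftTurn]; ring) fun x hx => (hint x hx).2
  have hexpand : ∀ i x, leftTurn (v i) (v (i + 1)) x = leftTurn (v i) (v (i + 1)) (y 0) +
      ξ x * (leftTurn (v i) (v (i + 1)) (y 1) - leftTurn (v i) (v (i + 1)) (y 0)) +
      η x * (leftTurn (v i) (v (i + 1)) (y 3) - leftTurn (v i) (v (i + 1)) (y 0)) := by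
    intro i x
    conv_lhs => rw [hcoord x]
    simp only [leftTurn, Pi.add_apply, Pi.smul_apply, Pi.sub_apply, smul_eq_mul]
    ring
  have hpar' : ∀ i, leftTurn (v i) (v (i + 1)) (y 0) + leftTurn (v i) (v (i + 1)) (y 2) =
      leftTurn (v i) (v (i + 1)) (y 1) + leftTurn (v i) (v (i + 1)) (y 3) := by
    intro i
    have h0 := congrFun hpar 0
    have h1 := congrFun hpar 1
    simp only [Pi.add_apply] at h0 h1
    unfold leftTurn
    linear_combination (v (i + 1) 0 - v i 0) * h1 - (v (i + 1) 1 - v i 1) * h0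
  have hzero := leftTurn_side_eq_zero hy
  have hpos : ∀ i j, j ≠ i → 0 < leftTurn (v i) (v (i + 1)) (y j) /
      leftTurn (v i) (v (i + 1)) (realPoint f) := fun i j hij =>
    div_pos (leftTurn_side_pos hv hy hij) (hG i)
  have hineq : ∀ i, ∀ z ∈ relaxation R f, ∀ p q : ℝ,
      leftTurn (v i) (v (i + 1)) z.1 = p →
      p / leftTurn (v i) (v (i + 1)) (realPoint f) = q → 1 ≤ height α z + q := by
    rintro i z hz p q rfl rfl
    have h := leftTurn_le_of_mem_relaxation hα (hnonneg i) hz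
    have h2 := div_le_div_of_nonneg_right h (hG i).le
    rwa [div_self (hG i).ne', add_div, mul_div_cancel_left₀ _ (hG i).ne'] at h2
  -- The coefficients for side `i` are its normalized values at the two corners adjacent to `y i`;
  -- `hpar'` eliminates the value at the opposite corner.
  obtain ⟨n, hn⟩ := eventually_one_le_height (α := α) (convex_relaxation R f) hX hY
    (hpos 0 1 (by decide)) (hpos 0 3 (by decide)) (hpos 1 0 (by decide)) (hpos 1 2 (by decide))
    (hpos 2 3 (by decide)) (hpos 2 1 (by decide)) (hpos 3 2 (by decide)) (hpos 3 0 (by decide))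
    (fun z hz => Finset.sum_nonneg fun j _ => mul_nonneg (hα j) (hz.1 j))
    (fun z hz => by
      rw [add_assoc]
      refine hineq 0 z hz _ _ (hexpand 0 z.1) ?_
      rw [hzero 0]
      ring)
    (fun z hz => by
      rw [add_assoc]
      refine hineq 1 z hz _ _ (hexpand 1 z.1) ?_
      have h3 : leftTurn (v 1) (v (1 + 1)) (y 3) =
        leftTurn (v 1) (v (1 + 1)) (y 0) + leftTurn (v 1) (v (1 + 1)) (y 2) := by
        linarith [hpar' 1, hzero 1]
      rw [h3, hzero 1]
      ring)
    (fun z hz => by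
      rw [add_assoc]
      refine hineq 2 z hz _ _ (hexpand 2 z.1) ?_
      have h0 : leftTurn (v 2) (v (2 + 1)) (y 0) =
        leftTurn (v 2) (v (2 + 1)) (y 1) + leftTurn (v 2) (v (2 + 1)) (y 3) := by
        linarith [hpar' 2, hzero 2]
      rw [h0]
      ring)
    (fun z hz => by
      rw [add_assoc]
      refine hineq 3 z hz _ _ (hexpand 3 z.1) ?_
      have h1 : leftTurn (v 3) (v (3 + 1)) (y 1) =
        leftTurn (v 3) (v (3 + 1)) (y 0) + leftTurn (v 3) (v (3 + 1)) (y 2) := by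
        linarith [hpar' 3, hzero 3]
      rw [h1, hzero 3]
      ring)
  exact lt_of_le_of_lt (sInf_le (a := (n : ℕ∞)) ⟨n, rfl, hn⟩) (ENat.natCast_lt_top n)
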